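/- Let $q$ be a prime power, let $m\ge 1$ and $n\ge 0$ be integers. For $\mathbf x\in \mathrm{GF}(q^m)^n$ let the rank weight $\mathrm{rk}(\mathbf x)$ be the maximum number of coordinates of $\mathbf x$ that are linearly independent over $\mathrm{GF}(q)$, and let $d_R(\mathbf x,\mathbf y)=\mathrm{rk}(\mathbf x-\mathbf y)$ be the rank distance. Put $\alpha(a,r)=\prod_{i=0}^{r-1}(q^a-q^i)$ (so $\alpha(a,0)=1$), ${a\brack r}=\alpha(a,r)/\alpha(r,r)$ for $r\ge 0$, ${a\brack r}=0$ for $r<0$, $N_r={n\brack r}\alpha(m,r)$, and for $j\ge 0$ and $0\le i\le n$ let $$K_j(i)=\sum_{l=0}^{j}(-1)^{j-l}q^{lm+\binom{j-l}{2}}{n-l\brack n-j}{n-i\brack l}$$ (with $K_j(i)=0$ for $j>n$) be the $q$-Krawtchouk polynomials. Then $N_r$ is the number of vectors of rank weight $r$ in $\mathrm{GF}(q^m)^n$, for every $r\ge 0$. Moreover, for all integers $u,s\ge 0$ and all $\mathbf x,\mathbf y\in\mathrm{GF}(q^m)^n$ with $d_R(\mathbf x,\mathbf y)=w$, the number $J_R(u,s,w)$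 of vectors $\mathbf z\in\mathrm{GF}(q^m)^n$ with $d_R(\mathbf x,\mathbf z)=u$ and $d_R(\mathbf y,\mathbf z)=s$ depends only on $u,s,w$ and equals $$J_R(u,s,w)=\frac{1}{q^{mn}N_w}\sum_{i=0}^{n}N_i\,K_u(i)\,K_s(i)\,K_w(i),$$ and the number $I(u,s,w)$ of vectors $\mathbf z$ with $d_R(\mathbf x,\mathbf z)\le u$ and $d_R(\mathbf y,\mathbf z)\le s$ equals $$I(u,s,w)=\sum_{a=0}^{u}\sum_{b=0}^{s}J_R(a,b,w)=\sum_{a=0}^{u}\sum_{b=0}^{s}\frac{1}{q^{mn}N_w}\sum_{i=0}^{n}N_i\,K_a(i)\,K_b(i)\,K_w(i).$$ -/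

import Mathlib

/-- The rank weight of `x` in `GF(q^m)^n`: the maximum number of coordinates of `x` that are
linearly independent over the subfield `F = GF(q)`. -/
noncomputable def rankWeight (F : Type*) {K : Type*} [Field F] [Field K] [Algebra F K] {n : ℕ}
    (x : Fin n → K) : ℕ :=
  open Classical in
  (Finset.univ.filter fun t : Finset (Fin n) => LinearIndepOn F x (t : Set (Fin n))).sup
    Finset.card

/-- The rank distance. -/
noncomputable def rankDist (F : Type*) {K : Type*} [Field F] [Field K] [Algebra F K] {n : ℕ}
    (x y : Fin n → K) : ℕ :=
  rankWeight F (x - y)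

/-- The sphere of rank radius `r` centred at `x`. -/
def rankSphere (F : Type*) {K : Type*} [Field F] [Field K] [Algebra F K] {n : ℕ}
    (x : Fin n → K) (r : ℕ) : Set (Fin n → K) :=
  {z | rankDist F x z = r}

/-- The ball of rank radius `r` centred at `x`. -/
def rankBall (F : Type*) {K : Type*} [Field F] [Field K] [Algebra F K] {n : ℕ}
    (x : Fin n → K) (r : ℕ) : Set (Fin n → K) :=
  {z | rankDist F x z ≤ r}

/-- `α(a, r) = ∏_{i=0}^{r-1} (q^a - q^i)`. -/
def qAlpha (q a r : ℕ) : ℚ :=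
  ∏ i ∈ Finset.range r, ((q : ℚ) ^ a - (q : ℚ) ^ i)

/-- The Gaussian binomial `[a, r] = α(a, r) / α(r, r)`. The lower index is an integer, and the
value is `0` when it is negative, as usual. -/
def qBinom (q a : ℕ) (r : ℤ) : ℚ :=
  if r < 0 then 0 else qAlpha q a r.toNat / qAlpha q r.toNat r.toNat

/-- `N_r = [n, r] α(m, r)`. -/
def rankCount (q m n r : ℕ) : ℚ :=
  qBinom q n r * qAlpha q m r

/-- The `q`-Krawtchouk polynomial
`K_j(i) = ∑_{l=0}^j (-1)^(j-l) q^(l m + (j-l choose 2)) [n-l, n-j] [n-i, l]` for `0 ≤ i ≤ n`.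
The difference `n - j` is taken in `ℤ`, so that `K_j(i) = 0` for `j > n`. -/
def qKrawtchouk (q m n j i : ℕ) : ℚ :=
  ∑ l ∈ Finset.range (j + 1),
    (-1) ^ (j - l) * (q : ℚ) ^ (l * m + (j - l).choose 2) *
      qBinom q (n - l) ((n : ℤ) - (j : ℤ)) * qBinom q (n - i) l

/-!
A vector `x` of `Kⁿ` is an `F`-linear map `Fⁿ → K`; its range is the span of the coordinates, so the
rank weight of `x` is `n` minus the dimension of its kernel `coordRelations F x`. A vector of rank
weight `r` is therefore a kernel of codimension `r` together with an independent `r`-tuple of `K`,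
which gives `N_r` (`natCard_rankWeight_eq`).

For the intersection numbers, fix a primitive additive character `ψ` of `K` and take Fourier
transforms with respect to the pairing `ψ (x ⬝ᵥ y)`. For a subspace `W` of `Fⁿ` of codimension `l`,
the `x` whose kernel contains `W` form a subgroup with `q^(lm)` elements, and `ψ (x ⬝ᵥ y)` is trivial
on it exactly when the kernel of `y` contains the orthogonal complement of `W`
(`sum_vecsOfRelations`). Summing over all such `W` gives, for the transforms `P_r` of the rank
spheres, the triangular system `∑ r, [n - r, n - l] P_r(y) = q^(lm) [n - rk y, l]`
(`sum_qBinom_mul_rankCharSum`). Gaussian inversion, which rests on the telescoping of the alternating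
`q`-binomial sum (`sum_neg_one_pow_div_qFactor`), solves it: `P_j(y) = K_j(rk y)`
(`rankCharSum_eq_qKrawtchouk`).

The number of `z` at distances `u` and `s` from `x` and `y` is a convolution of two spheres, so
Fourier inversion gives `q^(mn) J = ∑ i, K_u(i) K_s(i) K_i(w)`
(`ncard_rankSphere_inter_mul_card`). Counting the sum of `ψ (x ⬝ᵥ y)` over two spheres in two orders
gives the symmetry `N_w K_i(w) = N_i K_w(i)` (`rankCount_mul_qKrawtchouk_comm`), hence the stated
form. Balls are disjoint unions of spheres.
-/

/-! ### Gaussian binomials -/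

/-- The `q`-factorial up to a power of `q - 1`: `(q - 1)(q² - 1)⋯(q^a - 1)`. -/
def qFactor (q a : ℕ) : ℚ :=
  ∏ i ∈ Finset.range a, ((q : ℚ) ^ (i + 1) - 1)

lemma qFactor_succ (q a : ℕ) : qFactor q (a + 1) = qFactor q a * ((q : ℚ) ^ (a + 1) - 1) :=
  Finset.prod_range_succ _ _

lemma qFactor_ne_zero {q : ℕ} (hq : 2 ≤ q) (a : ℕ) : qFactor q a ≠ 0 := by
  refine Finset.prod_ne_zero_iff.2 fun i _ ↦ ?_
  have : (1 : ℚ) < (q : ℚ) ^ (i + 1) :=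
    one_lt_pow₀ (by exact_mod_cast hq) (Nat.succ_ne_zero i)
  linarith

lemma qAlpha_add_mul_qFactor (q b c : ℕ) :
    qAlpha q (b + c) b * qFactor q c = (q : ℚ) ^ b.choose 2 * qFactor q (b + c) := by
  induction b generalizing c with
  | zero => simp [qAlpha]
  | succ b ih =>
    have h := ih (c + 1)
    rw [qFactor_succ, show b + (c + 1) = b + 1 + c by ring] at h
    rw [qAlpha, Finset.prod_range_succ, ← qAlpha, Nat.choose_succ_succ' b 1, Nat.choose_one_right,
      pow_add (q : ℚ) b, mul_assoc ((q : ℚ) ^ b), ← h]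
    ring

lemma qAlpha_eq_zero_of_lt {q a r : ℕ} (h : a < r) : qAlpha q a r = 0 :=
  Finset.prod_eq_zero (Finset.mem_range.2 h) (sub_self _)

lemma qAlpha_self_ne_zero {q : ℕ} (hq : 2 ≤ q) (r : ℕ) : qAlpha q r r ≠ 0 := by
  have h := qAlpha_add_mul_qFactor q r 0
  have hq0 : (q : ℚ) ≠ 0 := by exact_mod_cast (by lia : q ≠ 0)
  simp only [add_zero, qFactor, Finset.prod_range_zero, mul_one] at h
  rw [h]
  exact mul_ne_zero (pow_ne_zero _ hq0) (qFactor_ne_zero hq r)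

lemma qBinom_natCast (q a r : ℕ) : qBinom q a r = qAlpha q a r / qAlpha q r r := by
  simp [qBinom]

lemma qBinom_eq_zero_of_lt {q a r : ℕ} (h : a < r) : qBinom q a r = 0 := by
  rw [qBinom_natCast, qAlpha_eq_zero_of_lt h, zero_div]

lemma qBinom_add {q : ℕ} (hq : 2 ≤ q) (b c : ℕ) :
    qBinom q (b + c) b = qFactor q (b + c) / (qFactor q b * qFactor q c) := by
  have h1 := qAlpha_add_mul_qFactor q b c
  have h2 := qAlpha_add_mul_qFactor q b 0
  have hb := qFactor_ne_zero hq b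
  have hc := qFactor_ne_zero hq c
  have hα := qAlpha_self_ne_zero hq b
  simp only [add_zero, qFactor, Finset.prod_range_zero, mul_one] at h2
  rw [← qFactor] at h2
  rw [qBinom_natCast, div_eq_div_iff hα (mul_ne_zero hb hc), h2]
  linear_combination qFactor q b * h1

/-- Partial sums of the alternating Gaussian binomial sum telescope. -/
lemma sum_neg_one_pow_div_qFactor_partial {q : ℕ} (hq : 2 ≤ q) {J N : ℕ} (h : N ≤ J) :
    ∑ k ∈ Finset.range (N + 1), (-1) ^ k * (q : ℚ) ^ k.choose 2 /
        (qFactor q k * qFactor q (J + 1 - k)) * ((q : ℚ) ^ (J + 1) - 1) =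
      (-1) ^ N * (q : ℚ) ^ (N + 1).choose 2 / (qFactor q N * qFactor q (J - N)) := by
  induction N with
  | zero =>
    have hJ := qFactor_ne_zero hq (J + 1)
    have hJ' := qFactor_ne_zero hq J
    have h0 : qFactor q 0 = 1 := by simp [qFactor]
    rw [qFactor_succ] at hJ
    have := right_ne_zero_of_mul hJ
    simp [h0, qFactor_succ]
    field_simp
  | succ N ih =>
    obtain ⟨c, rfl⟩ := Nat.exists_eq_add_of_le h
    rw [Finset.sum_range_succ, ih (by lia), show N + 1 + c - N = c + 1 by lia,
      show N + 1 + c + 1 - (N + 1) = c + 1 by lia, show N + 1 + c - (N + 1) = c by lia,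
      Nat.choose_succ_succ' (N + 1) 1, Nat.choose_one_right]
    have h1 := qFactor_ne_zero hq (N + 1)
    have h2 := qFactor_ne_zero hq (c + 1)
    rw [qFactor_succ] at h1 h2
    have h3 := left_ne_zero_of_mul h1
    have h4 := right_ne_zero_of_mul h1
    have h5 := left_ne_zero_of_mul h2
    have h6 := right_ne_zero_of_mul h2
    rw [qFactor_succ, qFactor_succ]
    field_simp
    ring

/-- The case `z = 1` of Gauss's `q`-binomial theorem
`∑ (-1)ᵏ q^(k choose 2) [J, k] zᵏ = ∏ (1 - z qⁱ)`, divided by `qFactor q J`. -/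
lemma sum_neg_one_pow_div_qFactor {q : ℕ} (hq : 2 ≤ q) (J : ℕ) :
    ∑ k ∈ Finset.range (J + 1), (-1) ^ k * (q : ℚ) ^ k.choose 2 /
        (qFactor q k * qFactor q (J - k)) = if J = 0 then 1 else 0 := by
  rcases J with _ | J
  · simp [qFactor]
  have hJ := qFactor_ne_zero hq (J + 1)
  rw [qFactor_succ] at hJ
  have h0 : qFactor q 0 = 1 := by simp [qFactor]
  have hJ1 := right_ne_zero_of_mul hJ
  have hJ0 := left_ne_zero_of_mul hJ
  refine (mul_eq_zero.1 ?_).resolve_right hJ1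
  rw [Finset.sum_mul, Finset.sum_range_succ, sum_neg_one_pow_div_qFactor_partial hq le_rfl]
  simp only [Nat.sub_self, h0, qFactor_succ]
  field_simp
  ring

/-- Orthogonality of the Gaussian binomials that occur in the `q`-Krawtchouk polynomials. -/
lemma sum_qBinom_mul_qBinom {q : ℕ} (hq : 2 ≤ q) {n j r : ℕ} (hj : j ≤ n) (hr : r ≤ n) :
    ∑ l ∈ Finset.range (j + 1), (-1) ^ (j - l) * (q : ℚ) ^ (j - l).choose 2 *
        qBinom q (n - l) ((n - j : ℕ) : ℤ) * qBinom q (n - r) ((n - l : ℕ) : ℤ) =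
      if r = j then 1 else 0 := by
  rcases lt_or_ge j r with h | h
  · rw [if_neg (by lia)]
    refine Finset.sum_eq_zero fun l hl ↦ ?_
    rw [Finset.mem_range] at hl
    rw [qBinom_eq_zero_of_lt (show n - r < n - l by lia), mul_zero]
  obtain ⟨J, rfl⟩ := Nat.exists_eq_add_of_le h
  obtain ⟨c, rfl⟩ := Nat.exists_eq_add_of_le hj
  rw [← Finset.sum_flip]
  have hsub : Finset.range (J + 1) ⊆ Finset.range (r + J + 1) :=
    Finset.range_mono (by lia)
  rw [← Finset.sum_subset hsub]
  · calc _ = ∑ k ∈ Finset.range (J + 1), (qFactor q (c + J) / qFactor q c) *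
          ((-1) ^ k * (q : ℚ) ^ k.choose 2 / (qFactor q k * qFactor q (J - k))) := by
          refine Finset.sum_congr rfl fun k hk ↦ ?_
          rw [Finset.mem_range] at hk
          obtain ⟨t, rfl⟩ := Nat.exists_eq_add_of_le (show k ≤ J by lia)
          rw [show r + (k + t) - (r + (k + t) - k) = k by lia,
            show r + (k + t) + c - (r + (k + t) - k) = c + k by lia,
            show r + (k + t) + c - (r + (k + t)) = c by lia,
            show r + (k + t) + c - r = (c + k) + t by lia, show k + t - k = t by lia,
            qBinom_add hq, qBinom_add hq, ← add_assoc]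
          have h1 := qFactor_ne_zero hq k
          have h2 := qFactor_ne_zero hq t
          have h3 := qFactor_ne_zero hq c
          have h4 := qFactor_ne_zero hq (c + k)
          field_simp
      _ = _ := by
          rw [← Finset.mul_sum, sum_neg_one_pow_div_qFactor hq]
          rcases J with _ | J
          · simp [qFactor_ne_zero hq c]
          · simp
  · intro k hk hk'
    simp only [Finset.mem_range, not_lt] at hk hk'
    rw [qBinom_eq_zero_of_lt
      (show r + J + c - r < r + J + c - (r + J - k) by lia), mul_zero]

/-- Inversion of the triangular system with matrix `[n - r, n - l]`. -/
lemma eq_sum_of_sum_qBinom_mul_eq {q : ℕ} (hq : 2 ≤ q) {n : ℕ} {P R : ℕ → ℂ}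
    (h : ∀ l ≤ n, ∑ r ∈ Finset.range (n + 1),
      (qBinom q (n - r) ((n - l : ℕ) : ℤ) : ℂ) * P r = R l) {j : ℕ} (hj : j ≤ n) :
    P j = ∑ l ∈ Finset.range (j + 1), (-1) ^ (j - l) * (q : ℂ) ^ (j - l).choose 2 *
      (qBinom q (n - l) ((n - j : ℕ) : ℤ) : ℂ) * R l := by
  calc P j = ∑ r ∈ Finset.range (n + 1), ((if r = j then 1 else 0 : ℚ) : ℂ) * P r := by
        rw [Finset.sum_eq_single_of_mem j (Finset.mem_range.2 (Nat.lt_succ_of_le hj))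
          fun r _ hr ↦ by simp [hr]]
        simp
    _ = ∑ r ∈ Finset.range (n + 1), ∑ l ∈ Finset.range (j + 1),
        (-1) ^ (j - l) * (q : ℂ) ^ (j - l).choose 2 *
          (qBinom q (n - l) ((n - j : ℕ) : ℤ) : ℂ) *
          ((qBinom q (n - r) ((n - l : ℕ) : ℤ) : ℂ) * P r) := by
        refine Finset.sum_congr rfl fun r hr ↦ ?_
        rw [← sum_qBinom_mul_qBinom hq hj (Nat.lt_succ_iff.1 (Finset.mem_range.1 hr))]
        push_cast
        rw [Finset.sum_mul]
        exact Finset.sum_congr rfl fun l _ ↦ by ring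
    _ = _ := by
        rw [Finset.sum_comm]
        refine Finset.sum_congr rfl fun l hl ↦ ?_
        rw [Finset.mem_range] at hl
        rw [← Finset.mul_sum, h l (by lia)]

/-! ### Counting subspaces -/

section Subspaces

variable {F V : Type*} [Field F] [Finite F] [AddCommGroup V] [Module F V]

lemma two_le_natCard_field (F : Type*) [Field F] [Finite F] : 2 ≤ Nat.card F :=
  Finite.one_lt_card

lemma natCard_linearIndependent [Finite V] (k : ℕ) :
    (Nat.card {s : Fin k → V // LinearIndependent F s} : ℚ) =
      qAlpha (Nat.card F) (Module.finrank F V) k := by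
  have := Fintype.ofFinite F
  rcases le_or_gt k (Module.finrank F V) with h | h
  · rw [card_linearIndependent h, qAlpha, Finset.prod_range, ← Nat.card_eq_fintype_card]
    push_cast
    refine Finset.prod_congr rfl fun i _ ↦ ?_
    rw [Nat.cast_sub (Nat.pow_le_pow_right Nat.card_pos (i.2.le.trans h))]
    push_cast
    rfl
  · have : IsEmpty {s : Fin k → V // LinearIndependent F s} :=
      ⟨fun s ↦ by simpa using (s.2.fintype_card_le_finrank).trans_lt h⟩
    rw [Nat.card_of_isEmpty, qAlpha_eq_zero_of_lt h, Nat.cast_zero]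

/-- The Gaussian binomial counts subspaces: every independent `k`-tuple of `V` is a basis of
exactly one `k`-dimensional subspace. -/
lemma natCard_submodule_finrank_eq [Finite V] (k : ℕ) :
    (Nat.card {U : Submodule F V // Module.finrank F U = k} : ℚ) =
      qBinom (Nat.card F) (Module.finrank F V) k := by
  rw [qBinom_natCast, eq_div_iff (qAlpha_self_ne_zero (two_le_natCard_field F) k),
    ← natCard_linearIndependent (F := F) (V := V)]
  let f : {s : Fin k → V // LinearIndependent F s} →
      {U : Submodule F V // Module.finrank F U = k} :=
    fun s ↦ ⟨Submodule.span F (Set.range s.1), by simpa using finrank_span_eq_card s.2⟩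
  have hf (U : {U : Submodule F V // Module.finrank F U = k}) :
      (Nat.card {s // f s = U} : ℚ) = qAlpha (Nat.card F) k k := by
    have hspan (t : Fin k → U.1) (ht : LinearIndependent F t) :
        Submodule.span F (Set.range (U.1.subtype ∘ t)) = U.1 := by
      rw [Set.range_comp, ← Submodule.map_span, ht.span_eq_top_of_card_eq_finrank' (by simp [U.2]),
        Submodule.map_top, Submodule.range_subtype]
    have hα := natCard_linearIndependent (F := F) (V := U.1) k
    rw [U.2] at hα
    rw [← hα]
    congr 1
    refine (Nat.card_congr (Equiv.ofBijective (fun t : {t : Fin k → U.1 // LinearIndependent F t} ↦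
      (⟨⟨U.1.subtype ∘ t.1, t.2.map' _ (Submodule.ker_subtype _)⟩,
        Subtype.ext (hspan t.1 t.2)⟩ : {s // f s = U})) ⟨fun t t' h ↦ ?_, ?_⟩)).symm
    · have h' : U.1.subtype ∘ t.1 = U.1.subtype ∘ t'.1 :=
        congrArg (fun s : {s // f s = U} ↦ s.1.1) h
      exact Subtype.ext (U.1.subtype_injective.comp_left h')
    · rintro ⟨⟨s, hs⟩, rfl⟩
      refine ⟨⟨fun i ↦ ⟨s i, Submodule.subset_span ⟨i, rfl⟩⟩, ?_⟩, rfl⟩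
      exact LinearIndependent.of_comp (Submodule.span F (Set.range s)).subtype hs
  have := Fintype.ofFinite {U : Submodule F V // Module.finrank F U = k}
  rw [← Nat.card_congr (Equiv.sigmaFiberEquiv f), Nat.card_sigma]
  push_cast
  simp [hf]

lemma natCard_submodule_le_finrank_eq [Finite V] (X : Submodule F V) (k : ℕ) :
    (Nat.card {U : Submodule F V // U ≤ X ∧ Module.finrank F U = k} : ℚ) =
      qBinom (Nat.card F) (Module.finrank F X) k := by
  rw [← natCard_submodule_finrank_eq (F := F) (V := X)]
  congr 1
  refine (Nat.card_congr (Equiv.ofBijective (fun U : {U : Submodule F X // Module.finrank F U = k} ↦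
    (⟨U.1.map X.subtype, Submodule.map_subtype_le _ _, by
      rw [Submodule.finrank_map_subtype_eq, U.2]⟩ :
      {U : Submodule F V // U ≤ X ∧ Module.finrank F U = k})) ⟨fun U U' h ↦ ?_, ?_⟩)).symm
  · exact Subtype.ext (Submodule.map_injective_of_injective X.subtype_injective
      (congrArg Subtype.val h))
  · rintro ⟨U, hU, hk⟩
    refine ⟨⟨U.comap X.subtype, ?_⟩, Subtype.ext ?_⟩
    · rw [← hk, (Submodule.comapSubtypeEquivOfLe hU).finrank_eq]
    · simpa using hU

end Subspaces

/-! ### The orthogonal complement in `Fⁿ` -/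

section Perp

variable {F : Type*} [Field F] {n : ℕ}

/-- The orthogonal complement for the dot product of `Fⁿ`. -/
def dotPerp (U : Submodule F (Fin n → F)) : Submodule F (Fin n → F) :=
  LinearMap.BilinForm.orthogonal (dotProductBilin F F) U

lemma dotProductBilin_nondegenerate :
    LinearMap.BilinForm.Nondegenerate (dotProductBilin F F : LinearMap.BilinForm F (Fin n → F)) :=
  ⟨fun x h ↦ dotProduct_eq_zero x h,
    fun x h ↦ dotProduct_eq_zero x fun y ↦ (dotProduct_comm x y).trans (h y)⟩

lemma dotPerp_dotPerp (U : Submodule F (Fin n → F)) : dotPerp (dotPerp U) = U :=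
  LinearMap.BilinForm.orthogonal_orthogonal dotProductBilin_nondegenerate
    (fun x y h ↦ (dotProduct_comm y x).trans h) U

lemma finrank_dotPerp (U : Submodule F (Fin n → F)) :
    Module.finrank F (dotPerp U) = n - Module.finrank F U := by
  have h := LinearMap.BilinForm.finrank_orthogonal dotProductBilin_nondegenerate U
  rwa [Module.finrank_fin_fun] at h

end Perp

/-! ### Linear relations between the coordinates -/

section Relations

variable {F K : Type*} [Field F] [Field K] [Algebra F K] {n : ℕ}

/-- The rank weight is the dimension of the span of the coordinates. -/
lemma rankWeight_eq_finrank_span (x : Fin n → K) :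
    rankWeight F x = Module.finrank F (Submodule.span F (Set.range x)) := by
  classical
  have : FiniteDimensional F (Submodule.span F (Set.range x)) :=
    FiniteDimensional.span_of_finite F (Set.finite_range x)
  rw [rankWeight]
  apply le_antisymm
  · refine Finset.sup_le fun t ht ↦ ?_
    have ht' : LinearIndepOn F x (t : Set (Fin n)) := by simpa using ht
    have h := finrank_span_eq_card ht'
    rw [← Set.toFinset_card, Finset.toFinset_coe] at h
    rw [← h]
    exact Submodule.finrank_mono (Submodule.span_mono (by rintro _ ⟨i, rfl⟩; exact ⟨i, rfl⟩))
  · obtain ⟨b, -, -, hb, hli⟩ := exists_linearIndepOn_extension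
      (linearIndepOn_empty F x) (Set.empty_subset Set.univ)
    have hspan : Submodule.span F (Set.range x) = Submodule.span F (x '' b) :=
      le_antisymm (Submodule.span_le.2 (by simpa using hb))
        (Submodule.span_mono (Set.image_subset_range _ _))
    have h := finrank_span_eq_card hli
    rw [show (Set.range fun i : b ↦ x i) = x '' b from by ext; simp, ← hspan] at h
    rw [h, ← Set.toFinset_card]
    exact Finset.le_sup (f := Finset.card) (by simpa using hli)

/-- The vectors of coefficients of the `F`-linear relations between the coordinates of `x`. -/
noncomputable def coordRelations (F : Type*) {K : Type*} [Field F] [Field K] [Algebra F K] {n : ℕ}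
    (x : Fin n → K) : Submodule F (Fin n → F) :=
  LinearMap.ker (Module.piEquiv (Fin n) F K x)

lemma mem_coordRelations {x : Fin n → K} {a : Fin n → F} :
    a ∈ coordRelations F x ↔ ∑ i, a i • x i = 0 := by
  rw [coordRelations, LinearMap.mem_ker, Module.piEquiv_apply_apply]

lemma finrank_coordRelations_add_rankWeight (x : Fin n → K) :
    Module.finrank F (coordRelations F x) + rankWeight F x = n := by
  have h := LinearMap.finrank_range_add_finrank_ker (Module.piEquiv (Fin n) F K x)
  rw [Module.range_piEquiv, Module.finrank_fin_fun] at h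
  rw [rankWeight_eq_finrank_span, coordRelations, add_comm, h]

lemma rankWeight_le (x : Fin n → K) : rankWeight F x ≤ n := by
  have := finrank_coordRelations_add_rankWeight (F := F) x
  lia

lemma rankWeight_neg (x : Fin n → K) : rankWeight F (-x) = rankWeight F x := by
  have h : coordRelations F (-x) = coordRelations F x := by
    ext a
    simp [mem_coordRelations]
  have h1 := finrank_coordRelations_add_rankWeight (F := F) x
  have h2 := finrank_coordRelations_add_rankWeight (F := F) (-x)
  rw [h] at h2
  lia

variable [Finite F] [Finite K]

/-- A linear map with kernel `W` is determined by the images of a basis of the quotient by `W`,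
which form an arbitrary independent tuple. -/
lemma natCard_coordRelations_eq {r : ℕ} (W : Submodule F (Fin n → F))
    (hW : Module.finrank F W + r = n) :
    (Nat.card {x : Fin n → K // coordRelations F x = W} : ℚ) =
      qAlpha (Nat.card F) (Module.finrank F K) r := by
  rw [← natCard_linearIndependent (F := F) (V := K)]
  congr 1
  have hr : Module.finrank F ((Fin n → F) ⧸ W) = r := by
    have := W.finrank_quotient_add_finrank
    rw [Module.finrank_fin_fun] at this
    lia
  let b := Module.finBasisOfFinrankEq F _ hr
  have hker (v : Fin r → K) (hv : LinearIndependent F v) :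
      coordRelations F ((Module.piEquiv (Fin n) F K).symm (b.constr F v ∘ₗ W.mkQ)) = W := by
    have hbot : LinearMap.ker (b.constr F v) = ⊥ := by
      refine LinearMap.ker_eq_bot'.2 fun x hx ↦ ?_
      rw [Module.Basis.constr_apply_fintype] at hx
      exact b.equivFun.map_eq_zero_iff.1 (funext (Fintype.linearIndependent_iff.1 hv _ hx))
    rw [coordRelations, LinearEquiv.apply_symm_apply, LinearMap.ker_comp, hbot,
      Submodule.comap_bot, Submodule.ker_mkQ]
  refine (Nat.card_congr (Equiv.ofBijective (fun v : {v : Fin r → K // LinearIndependent F v} ↦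
    (⟨_, hker v.1 v.2⟩ : {x : Fin n → K // coordRelations F x = W})) ⟨fun v v' h ↦ ?_, ?_⟩)).symm
  · have h1 := (Module.piEquiv (Fin n) F K).symm.injective (congrArg Subtype.val h)
    have h2 := LinearMap.cancel_right (Submodule.mkQ_surjective W) |>.1 h1
    exact Subtype.ext ((b.constr F).injective h2)
  · rintro ⟨x, rfl⟩
    let T := (coordRelations F x).liftQ (Module.piEquiv (Fin n) F K x) le_rfl
    have hT : LinearMap.ker T = ⊥ := Submodule.ker_liftQ_eq_bot _ _ _ le_rfl
    refine ⟨⟨T ∘ b, b.linearIndependent.map' T hT⟩, Subtype.ext ?_⟩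
    have : b.constr F (T ∘ b) = T := b.ext fun i ↦ by simp
    simp only [this]
    rw [LinearEquiv.symm_apply_eq]
    exact Submodule.liftQ_mkQ _ _ _

/-- The number of vectors of rank weight `r`. -/
lemma natCard_rankWeight_eq (r : ℕ) :
    (Nat.card {x : Fin n → K // rankWeight F x = r} : ℚ) =
      rankCount (Nat.card F) (Module.finrank F K) n r := by
  rcases lt_or_ge n r with h | h
  · have : IsEmpty {x : Fin n → K // rankWeight F x = r} :=
      ⟨fun x ↦ by have := rankWeight_le (F := F) x.1; have := x.2; lia⟩
    rw [Nat.card_of_isEmpty, rankCount, qBinom_eq_zero_of_lt h, zero_mul, Nat.cast_zero]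
  let f : {x : Fin n → K // rankWeight F x = r} →
      {U : Submodule F (Fin n → F) // Module.finrank F U = r} :=
    fun x ↦ ⟨dotPerp (coordRelations F x.1), by
      have := finrank_coordRelations_add_rankWeight (F := F) x.1
      rw [finrank_dotPerp]
      have := x.2
      lia⟩
  have hf (U : {U : Submodule F (Fin n → F) // Module.finrank F U = r}) :
      (Nat.card {x // f x = U} : ℚ) = qAlpha (Nat.card F) (Module.finrank F K) r := by
    have hU : Module.finrank F (dotPerp U.1) + r = n := by
      rw [finrank_dotPerp, U.2]
      lia
    rw [← natCard_coordRelations_eq (F := F) (K := K) _ hU]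
    congr 1
    refine Nat.card_congr (Equiv.ofBijective (fun x : {x // f x = U} ↦
      (⟨x.1.1, (dotPerp_dotPerp _).symm.trans (congrArg (dotPerp ·.1) x.2)⟩ :
        {x : Fin n → K // coordRelations F x = dotPerp U.1})) ⟨fun x y h ↦ ?_, ?_⟩)
    · have h' : x.1.1 = y.1.1 := Subtype.mk.inj h
      exact Subtype.ext (Subtype.ext h')
    · rintro ⟨x, hx⟩
      have hx' := finrank_coordRelations_add_rankWeight (F := F) x
      rw [hx] at hx'
      exact ⟨⟨⟨x, by lia⟩, Subtype.ext (by simp only [f]; rw [hx, dotPerp_dotPerp])⟩, rfl⟩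
  have := Fintype.ofFinite {U : Submodule F (Fin n → F) // Module.finrank F U = r}
  rw [← Nat.card_congr (Equiv.sigmaFiberEquiv f), Nat.card_sigma]
  push_cast
  simp only [hf, Finset.sum_const, nsmul_eq_mul, rankCount]
  have h := natCard_submodule_finrank_eq (F := F) (V := Fin n → F) r
  rw [Module.finrank_fin_fun, Nat.card_eq_fintype_card] at h
  rw [← h, Finset.card_univ]

end Relations

/-! ### Character sums over vectors of given rank weight -/

section CharacterSums

open scoped Classical in
/-- The Fourier transform, at `y`, of the indicator function of the vectors of rank weight `j`. -/
noncomputable def rankCharSum (F : Type*) {K : Type*} [Field F] [Field K] [Algebra F K] [Fintype K]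
    {n : ℕ} (ψ : AddChar K ℂ) (j : ℕ) (y : Fin n → K) : ℂ :=
  ∑ x : Fin n → K with rankWeight F x = j, ψ (x ⬝ᵥ y)

/-- The vectors whose coordinates satisfy all the linear relations in `W`. -/
noncomputable def vecsOfRelations (K : Type*) {F : Type*} [Field F] [Field K] [Algebra F K] {n : ℕ}
    (W : Submodule F (Fin n → F)) : Submodule F (Fin n → K) :=
  LinearMap.ker (LinearMap.lcomp F K W.subtype ∘ₗ (Module.piEquiv (Fin n) F K).toLinearMap)

variable {F K : Type*} [Field F] [Field K] [Algebra F K] {n : ℕ}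

lemma mem_vecsOfRelations {W : Submodule F (Fin n → F)} {x : Fin n → K} :
    x ∈ vecsOfRelations K W ↔ W ≤ coordRelations F x := by
  rw [vecsOfRelations, LinearMap.mem_ker, LinearMap.ext_iff]
  simp only [Subtype.forall, LinearMap.comp_apply, LinearMap.lcomp_apply, LinearMap.zero_apply]
  rfl

lemma finrank_vecsOfRelations [FiniteDimensional F K] (W : Submodule F (Fin n → F)) :
    Module.finrank F (vecsOfRelations K W) = Module.finrank F (dotPerp W) * Module.finrank F K := by
  have h := LinearMap.finrank_range_add_finrank_ker
    (LinearMap.lcomp F K W.subtype ∘ₗ (Module.piEquiv (Fin n) F K).toLinearMap)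
  have hsurj : LinearMap.range
      (LinearMap.lcomp F K W.subtype ∘ₗ (Module.piEquiv (Fin n) F K).toLinearMap) = ⊤ := by
    refine LinearMap.range_eq_top.2 fun g ↦ ?_
    obtain ⟨T, hT⟩ := LinearMap.exists_extend g
    exact ⟨(Module.piEquiv (Fin n) F K).symm T, by simpa [LinearMap.lcomp_apply'] using hT⟩
  rw [hsurj, finrank_top, Module.finrank_linearMap, Module.finrank_pi_fintype, Finset.sum_const,
    Finset.card_univ, Fintype.card_fin, smul_eq_mul] at h
  rw [finrank_dotPerp, Nat.sub_mul, vecsOfRelations]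
  lia

/-- Expand `x` in a basis of `K` over `F`: the coefficient vectors are orthogonal to `W`, so that
they are relations between the coordinates of `y`. -/
lemma dotProduct_eq_zero_of_dotPerp_le [FiniteDimensional F K] {W : Submodule F (Fin n → F)}
    {x y : Fin n → K} (hx : x ∈ vecsOfRelations K W) (hy : dotPerp W ≤ coordRelations F y) :
    x ⬝ᵥ y = 0 := by
  let e := Module.finBasis F K
  have hmem (k) : (fun i ↦ e.repr (x i) k) ∈ dotPerp W := fun w hw ↦ by
    have h := mem_coordRelations.1 (mem_vecsOfRelations.1 hx hw)
    simpa [dotProductBilin, dotProduct] using congrArg (fun z ↦ e.repr z k) h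
  have hexp (i) : x i = ∑ k, e.repr (x i) k • e k := (e.sum_repr (x i)).symm
  calc x ⬝ᵥ y = ∑ i, (∑ k, e.repr (x i) k • e k) * y i :=
        Finset.sum_congr rfl fun i _ ↦ by rw [← hexp]
    _ = ∑ k, e k * ∑ i, e.repr (x i) k • y i := by
        simp_rw [Finset.sum_mul, Finset.mul_sum]
        rw [Finset.sum_comm]
        refine Finset.sum_congr rfl fun k _ ↦ Finset.sum_congr rfl fun i _ ↦ ?_
        rw [smul_mul_assoc, mul_smul_comm]
    _ = 0 := Finset.sum_eq_zero fun k _ ↦ by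
        rw [mem_coordRelations.1 (hy (hmem k)), mul_zero]

variable [Fintype K]

lemma sum_mul_rankCharSum (ψ : AddChar K ℂ) (g : ℕ → ℂ) (y : Fin n → K) :
    ∑ x : Fin n → K, g (rankWeight F x) * ψ (x ⬝ᵥ y) =
      ∑ r ∈ Finset.range (n + 1), g r * rankCharSum F ψ r y := by
  classical
  rw [← Finset.sum_fiberwise_of_maps_to (s := Finset.univ) (t := Finset.range (n + 1))
    (g := fun x : Fin n → K ↦ rankWeight F x)
    fun x _ ↦ Finset.mem_range.2 (Nat.lt_succ_of_le (rankWeight_le x))]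
  refine Finset.sum_congr rfl fun r _ ↦ ?_
  rw [rankCharSum, Finset.mul_sum]
  exact Finset.sum_congr (by congr) fun x hx ↦ by rw [(Finset.mem_filter.1 hx).2]

open scoped Classical in
/-- A character sum over the vectors satisfying the relations in `W`: either the character is
trivial on this subgroup, or the sum vanishes. -/
lemma sum_vecsOfRelations {ψ : AddChar K ℂ} (hψ : ψ.IsPrimitive) (W : Submodule F (Fin n → F))
    (y : Fin n → K) :
    ∑ x : Fin n → K with W ≤ coordRelations F x, ψ (x ⬝ᵥ y) =
      if dotPerp W ≤ coordRelations F y then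
        (Nat.card F : ℂ) ^ (Module.finrank F (dotPerp W) * Module.finrank F K) else 0 := by
  have hsub : ∑ x : Fin n → K with W ≤ coordRelations F x, ψ (x ⬝ᵥ y) =
      ∑ x : vecsOfRelations K W, ψ (x.1 ⬝ᵥ y) :=
    Finset.sum_subtype _ (by simp [mem_vecsOfRelations]) _
  rw [hsub]
  split_ifs with h
  · rw [Finset.sum_congr rfl fun x _ ↦ by
      rw [dotProduct_eq_zero_of_dotPerp_le x.2 h, AddChar.map_zero_eq_one],
      Finset.sum_const, Finset.card_univ, ← Nat.card_eq_fintype_card,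
      Module.natCard_eq_pow_finrank (K := F), finrank_vecsOfRelations]
    simp
  · obtain ⟨u, hu, hu'⟩ := Set.not_subset.1 h
    have hb : ∑ i, u i • y i ≠ 0 := fun hb ↦ hu' (mem_coordRelations.2 hb)
    obtain ⟨k, hk⟩ := AddChar.ne_one_iff.1 (hψ hb)
    let z : vecsOfRelations K W := ⟨fun i ↦ u i • k, by
      refine mem_vecsOfRelations.2 fun a ha ↦ mem_coordRelations.2 ?_
      simp_rw [smul_smul]
      rw [← Finset.sum_smul]
      have : ∑ i, a i * u i = 0 := hu a ha
      rw [this, zero_smul]⟩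
    have hz : z.1 ⬝ᵥ y = (∑ i, u i • y i) * k := by
      rw [dotProduct, Finset.sum_mul]
      refine Finset.sum_congr rfl fun i _ ↦ ?_
      rw [smul_mul_assoc, smul_mul_assoc, mul_comm]
    rw [AddChar.mulShift_apply, ← hz] at hk
    have hshift : ∑ x : vecsOfRelations K W, ψ (x.1 ⬝ᵥ y) =
        ψ (z.1 ⬝ᵥ y) * ∑ x : vecsOfRelations K W, ψ (x.1 ⬝ᵥ y) := by
      rw [Finset.mul_sum, ← Equiv.sum_comp (Equiv.addLeft z)]
      refine Finset.sum_congr rfl fun x _ ↦ ?_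
      rw [← AddChar.map_add_eq_mul, ← add_dotProduct]
      rfl
    have : (ψ (z.1 ⬝ᵥ y) - 1) * ∑ x : vecsOfRelations K W, ψ (x.1 ⬝ᵥ y) = 0 := by
      rw [sub_mul, one_mul, ← hshift, sub_self]
    exact (mul_eq_zero.1 this).resolve_left (sub_ne_zero.2 hk)

variable [Finite F]

/-- Sum `sum_vecsOfRelations` over all `W` of codimension `l`, and exchange the summations. -/
lemma sum_qBinom_mul_rankCharSum {ψ : AddChar K ℂ} (hψ : ψ.IsPrimitive) {l : ℕ} (hl : l ≤ n)
    (y : Fin n → K) :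
    ∑ r ∈ Finset.range (n + 1),
        (qBinom (Nat.card F) (n - r) ((n - l : ℕ) : ℤ) : ℂ) * rankCharSum F ψ r y =
      (Nat.card F : ℂ) ^ (l * Module.finrank F K) *
        (qBinom (Nat.card F) (n - rankWeight F y) l : ℂ) := by
  classical
  have := Fintype.ofFinite (Submodule F (Fin n → F))
  have hfin (x : Fin n → K) : Module.finrank F (coordRelations F x) = n - rankWeight F x := by
    have := finrank_coordRelations_add_rankWeight (F := F) x
    lia
  have hcard (x : Fin n → K) (k : ℕ) : (((Finset.univ.filter fun W : Submodule F (Fin n → F) ↦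
      W ≤ coordRelations F x ∧ Module.finrank F W = k).card : ℕ) : ℚ) =
        qBinom (Nat.card F) (n - rankWeight F x) k := by
    rw [← hfin, ← natCard_submodule_le_finrank_eq, Nat.card_eq_fintype_card, Fintype.card_subtype]
  have hperp : (Finset.univ.filter fun W : Submodule F (Fin n → F) ↦
      dotPerp W ≤ coordRelations F y ∧ Module.finrank F W = n - l).card =
      (Finset.univ.filter fun W : Submodule F (Fin n → F) ↦
        W ≤ coordRelations F y ∧ Module.finrank F W = l).card := by
    refine Finset.card_nbij' dotPerp dotPerp ?_ ?_ (fun W _ ↦ dotPerp_dotPerp W)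
      (fun W _ ↦ dotPerp_dotPerp W)
    · intro W hW
      simp only [Finset.coe_filter, Finset.mem_univ, true_and, Set.mem_ofPred_eq] at hW ⊢
      exact ⟨hW.1, by rw [finrank_dotPerp]; lia⟩
    · intro W hW
      simp only [Finset.coe_filter, Finset.mem_univ, true_and, Set.mem_ofPred_eq] at hW ⊢
      exact ⟨by rw [dotPerp_dotPerp]; exact hW.1, by rw [finrank_dotPerp]; lia⟩
  calc _ = ∑ x : Fin n → K, (((Finset.univ.filter fun W : Submodule F (Fin n → F) ↦
          W ≤ coordRelations F x ∧ Module.finrank F W = n - l).card : ℕ) : ℂ) * ψ (x ⬝ᵥ y) := by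
        rw [← sum_mul_rankCharSum ψ
          (fun r ↦ (qBinom (Nat.card F) (n - r) ((n - l : ℕ) : ℤ) : ℂ)) y]
        refine Finset.sum_congr rfl fun x _ ↦ ?_
        rw [← hcard]
        norm_cast
    _ = ∑ W ∈ Finset.univ.filter fun W : Submodule F (Fin n → F) ↦ Module.finrank F W = n - l,
          ∑ x : Fin n → K with W ≤ coordRelations F x, ψ (x ⬝ᵥ y) := by
        simp_rw [← nsmul_eq_mul, ← Finset.sum_const, Finset.sum_filter]
        rw [Finset.sum_comm]
        refine Finset.sum_congr rfl fun W _ ↦ ?_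
        split_ifs with h <;> simp [h]
    _ = ∑ W ∈ Finset.univ.filter fun W : Submodule F (Fin n → F) ↦ Module.finrank F W = n - l,
          if dotPerp W ≤ coordRelations F y then
            (Nat.card F : ℂ) ^ (l * Module.finrank F K) else 0 := by
        refine Finset.sum_congr rfl fun W hW ↦ ?_
        rw [sum_vecsOfRelations hψ, finrank_dotPerp, (Finset.mem_filter.1 hW).2, Nat.sub_sub_self hl]
    _ = _ := by
        rw [← hcard, ← hperp, ← Finset.sum_filter, Finset.filter_filter, Finset.sum_const,
          nsmul_eq_mul, mul_comm]
        simp_rw [and_comm]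
        norm_cast

/-- The Fourier transform of a rank sphere is the `q`-Krawtchouk polynomial. -/
lemma rankCharSum_eq_qKrawtchouk {ψ : AddChar K ℂ} (hψ : ψ.IsPrimitive) (j : ℕ) (y : Fin n → K) :
    rankCharSum F ψ j y =
      (qKrawtchouk (Nat.card F) (Module.finrank F K) n j (rankWeight F y) : ℂ) := by
  rcases lt_or_ge n j with h | h
  · have h1 : rankCharSum F ψ j y = 0 := by
      refine Finset.sum_eq_zero fun x hx ↦ ?_
      have h1 := rankWeight_le (F := F) x
      have h2 := (Finset.mem_filter.1 hx).2
      lia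
    rw [h1, qKrawtchouk, Finset.sum_eq_zero, Rat.cast_zero]
    intro l _
    rw [qBinom, if_pos (by lia)]
    simp
  · rw [eq_sum_of_sum_qBinom_mul_eq (two_le_natCard_field F)
      (fun l hl ↦ sum_qBinom_mul_rankCharSum hψ hl y) h, qKrawtchouk, ← Nat.cast_sub h]
    push_cast
    refine Finset.sum_congr rfl fun l _ ↦ ?_
    rw [pow_add]
    ring

/-- Both sides are the sum of `ψ (x ⬝ᵥ y)` over all `x` of rank weight `i` and `y` of rank
weight `w`. -/
lemma rankCount_mul_qKrawtchouk_comm (F K : Type*) [Field F] [Finite F] [Field K] [Finite K]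
    [Algebra F K] (n i w : ℕ) :
    rankCount (Nat.card F) (Module.finrank F K) n w *
        qKrawtchouk (Nat.card F) (Module.finrank F K) n i w =
      rankCount (Nat.card F) (Module.finrank F K) n i *
        qKrawtchouk (Nat.card F) (Module.finrank F K) n w i := by
  classical
  have := Fintype.ofFinite K
  let ψ := AddChar.FiniteField.primitiveChar_to_Complex K
  have hψ : ψ.IsPrimitive := AddChar.FiniteField.primitiveChar_to_Complex_isPrimitive K
  have key (i w : ℕ) : (rankCount (Nat.card F) (Module.finrank F K) n w *
      qKrawtchouk (Nat.card F) (Module.finrank F K) n i w : ℂ) =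
      ∑ y : Fin n → K with rankWeight F y = w, ∑ x : Fin n → K with rankWeight F x = i,
        ψ (x ⬝ᵥ y) := by
    rw [← natCard_rankWeight_eq, Nat.card_eq_fintype_card, Fintype.card_subtype, Rat.cast_natCast,
      ← nsmul_eq_mul, ← Finset.sum_const]
    refine Finset.sum_congr rfl fun y hy ↦ ?_
    rw [← (Finset.mem_filter.1 hy).2, ← rankCharSum_eq_qKrawtchouk hψ, rankCharSum]
  have h := (key i w).trans (Finset.sum_comm.trans
    ((Finset.sum_congr rfl fun x _ ↦ Finset.sum_congr rfl fun y _ ↦ by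
      rw [dotProduct_comm]).trans (key w i).symm))
  exact_mod_cast h

open scoped Classical in
lemma sum_addChar_dotProduct {ψ : AddChar K ℂ} (hψ : ψ.IsPrimitive) (x : Fin n → K) :
    ∑ y : Fin n → K, ψ (x ⬝ᵥ y) = if x = 0 then (Fintype.card K : ℂ) ^ n else 0 := by
  classical
  have hprod (s : Finset (Fin n)) (f : Fin n → K) : ψ (∑ i ∈ s, f i) = ∏ i ∈ s, ψ (f i) := by
    induction s using Finset.induction_on with
    | empty => simp
    | insert i s hi ih =>
      rw [Finset.sum_insert hi, Finset.prod_insert hi, AddChar.map_add_eq_mul, ih]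
  have h : ∑ y : Fin n → K, ψ (x ⬝ᵥ y) = ∏ i, ∑ t : K, ψ (t * x i) := by
    rw [Finset.prod_univ_sum, Fintype.piFinset_univ]
    refine Finset.sum_congr rfl fun y _ ↦ ?_
    rw [dotProduct, hprod]
    simp_rw [mul_comm]
  simp_rw [h, AddChar.sum_mulShift _ hψ]
  split_ifs with hx
  · simp [hx]
  · obtain ⟨i, hi⟩ := Function.ne_iff.1 hx
    exact Finset.prod_eq_zero (Finset.mem_univ i) (by simpa using hi)

end CharacterSums

/-! ### Intersections of spheres and balls -/

section Spheres

variable {F K : Type*} [Field F] [Field K] [Algebra F K] {n : ℕ}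

lemma mem_rankSphere {x z : Fin n → K} {r : ℕ} : z ∈ rankSphere F x r ↔ rankDist F x z = r :=
  Iff.rfl

lemma mem_rankBall {x z : Fin n → K} {r : ℕ} : z ∈ rankBall F x r ↔ rankDist F x z ≤ r :=
  Iff.rfl

lemma ncard_rankBall_inter [Finite K] (u s : ℕ) (x y : Fin n → K) :
    (rankBall F x u ∩ rankBall F y s).ncard =
      ∑ a ∈ Finset.range (u + 1), ∑ b ∈ Finset.range (s + 1),
        (rankSphere F x a ∩ rankSphere F y b).ncard := by
  classical
  have := Fintype.ofFinite K
  rw [Set.ncard_eq_toFinset_card', ← Finset.sum_product',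
    Finset.card_eq_sum_card_fiberwise (f := fun z ↦ (rankDist F x z, rankDist F y z))
      (t := Finset.range (u + 1) ×ˢ Finset.range (s + 1))]
  · refine Finset.sum_congr rfl fun p hp ↦ ?_
    rw [Set.ncard_eq_toFinset_card']
    congr 1
    ext z
    simp only [Finset.mem_product, Finset.mem_range] at hp
    simp only [mem_rankBall, mem_rankSphere, Finset.mem_filter, Set.mem_toFinset, Set.mem_inter_iff,
      Prod.ext_iff]
    lia
  · intro z hz
    simpa [mem_rankBall, Nat.lt_succ_iff] using hz

end Spheres

section Intersections

variable {F K : Type*} [Field F] [Finite F] [Field K] [Finite K] [Algebra F K] {n : ℕ}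

/-- Fourier inversion applied to the convolution of the indicator functions of two spheres. -/
lemma ncard_rankSphere_inter_mul_card (u s : ℕ) (x y : Fin n → K) :
    (((rankSphere F x u ∩ rankSphere F y s).ncard : ℕ) : ℚ) *
        (Nat.card F : ℚ) ^ (Module.finrank F K * n) =
      ∑ i ∈ Finset.range (n + 1), qKrawtchouk (Nat.card F) (Module.finrank F K) n u i *
        qKrawtchouk (Nat.card F) (Module.finrank F K) n s i *
        qKrawtchouk (Nat.card F) (Module.finrank F K) n i (rankDist F x y) := by
  classical
  have := Fintype.ofFinite K
  let ψ := AddChar.FiniteField.primitiveChar_to_Complex K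
  have hψ : ψ.IsPrimitive := AddChar.FiniteField.primitiveChar_to_Complex_isPrimitive K
  have hq : (Fintype.card K : ℂ) = (Nat.card F : ℂ) ^ Module.finrank F K := by
    rw [← Nat.card_eq_fintype_card, Module.natCard_eq_pow_finrank (K := F), Nat.cast_pow]
  -- Evaluate `∑ ψ ((a - b - (x - y)) ⬝ᵥ v)`, over `a` and `b` of rank weights `u` and `s` and over
  -- all `v`, in two ways.
  have h1 : ∑ v : Fin n → K, rankCharSum F ψ u v * rankCharSum F ψ s (-v) * ψ (-(x - y) ⬝ᵥ v) =
      ((rankSphere F x u ∩ rankSphere F y s).ncard : ℂ) *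
        (Nat.card F : ℂ) ^ (Module.finrank F K * n) := by
    have hexp (v : Fin n → K) :
        rankCharSum F ψ u v * rankCharSum F ψ s (-v) * ψ (-(x - y) ⬝ᵥ v) =
          ∑ a : Fin n → K with rankWeight F a = u, ∑ b : Fin n → K with rankWeight F b = s,
            ψ ((a - b - (x - y)) ⬝ᵥ v) := by
      simp_rw [rankCharSum, Finset.sum_mul_sum, Finset.sum_mul]
      refine Finset.sum_congr rfl fun a _ ↦ Finset.sum_congr rfl fun b _ ↦ ?_
      rw [← AddChar.map_add_eq_mul, ← AddChar.map_add_eq_mul]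
      congr 1
      simp only [dotProduct_neg, neg_dotProduct, sub_dotProduct]
      ring
    simp_rw [hexp]
    rw [Finset.sum_comm, Finset.sum_congr rfl fun a _ ↦ Finset.sum_comm]
    simp_rw [sum_addChar_dotProduct hψ, hq, ← pow_mul]
    rw [Set.ncard_eq_toFinset_card', ← nsmul_eq_mul, ← Finset.sum_const,
      ← Finset.sum_product', ← Finset.sum_filter]
    refine Finset.sum_nbij' (fun p ↦ x - p.1) (fun z ↦ (x - z, y - z)) ?_ ?_ ?_ ?_ ?_
    · rintro ⟨a, b⟩ h
      simp only [Finset.mem_filter, Finset.mem_product, Finset.mem_univ, true_and] at h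
      have hb : y - (x - a) = b := by linear_combination (exp := 1) h.2
      simp [mem_rankSphere, rankDist, hb, h.1]
    · intro z hz
      simpa [mem_rankSphere, rankDist] using hz
    · rintro ⟨a, b⟩ h
      simp only [Finset.mem_filter, Finset.mem_product, Finset.mem_univ, true_and] at h
      have hb : y - (x - a) = b := by linear_combination (exp := 1) h.2
      simp [hb]
    · intro z _
      simp
    · intros
      rfl
  have h2 : ∑ v : Fin n → K, rankCharSum F ψ u v * rankCharSum F ψ s (-v) * ψ (-(x - y) ⬝ᵥ v) =
      ∑ i ∈ Finset.range (n + 1), (qKrawtchouk (Nat.card F) (Module.finrank F K) n u i : ℂ) *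
        qKrawtchouk (Nat.card F) (Module.finrank F K) n s i *
        qKrawtchouk (Nat.card F) (Module.finrank F K) n i (rankDist F x y) := by
    simp_rw [rankCharSum_eq_qKrawtchouk hψ, rankWeight_neg, dotProduct_comm (-(x - y))]
    rw [sum_mul_rankCharSum ψ (fun i ↦ (qKrawtchouk (Nat.card F) (Module.finrank F K) n u i : ℂ) *
      qKrawtchouk (Nat.card F) (Module.finrank F K) n s i)]
    simp_rw [rankCharSum_eq_qKrawtchouk hψ, rankWeight_neg]
    rfl
  exact_mod_cast h1.symm.trans h2

lemma ncard_rankSphere_inter (u s : ℕ) (x y : Fin n → K) :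
    (((rankSphere F x u ∩ rankSphere F y s).ncard : ℕ) : ℚ) =
      1 / ((Nat.card F : ℚ) ^ (Module.finrank F K * n) *
          rankCount (Nat.card F) (Module.finrank F K) n (rankDist F x y)) *
        ∑ i ∈ Finset.range (n + 1), rankCount (Nat.card F) (Module.finrank F K) n i *
          qKrawtchouk (Nat.card F) (Module.finrank F K) n u i *
          qKrawtchouk (Nat.card F) (Module.finrank F K) n s i *
          qKrawtchouk (Nat.card F) (Module.finrank F K) n (rankDist F x y) i := by
  have hN : rankCount (Nat.card F) (Module.finrank F K) n (rankDist F x y) ≠ 0 := by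
    rw [← natCard_rankWeight_eq, Nat.cast_ne_zero]
    have : Nonempty {z : Fin n → K // rankWeight F z = rankDist F x y} := ⟨⟨x - y, rfl⟩⟩
    exact Nat.card_pos.ne'
  have hq : (Nat.card F : ℚ) ^ (Module.finrank F K * n) ≠ 0 :=
    pow_ne_zero _ (Nat.cast_ne_zero.2 Nat.card_pos.ne')
  rw [one_div, eq_inv_mul_iff_mul_eq₀ (mul_ne_zero hq hN), mul_comm, mul_comm (_ ^ _),
    mul_left_comm, ncard_rankSphere_inter_mul_card, Finset.mul_sum]
  refine Finset.sum_congr rfl fun i _ ↦ ?_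
  rw [mul_left_comm, rankCount_mul_qKrawtchouk_comm]
  ring

end Intersections

theorem lemma1 {F K : Type*} [Field F] [Finite F] [Field K] [Finite K] [Algebra F K]
    (q m n : ℕ) (hq : Nat.card F = q) (hm : Module.finrank F K = m) :
    -- the number of vectors of rank weight `r` is `N_r`
    (∀ r : ℕ, (({x : Fin n → K | rankWeight F x = r}.ncard : ℕ) : ℚ) = rankCount q m n r) ∧
    ∀ (u s w : ℕ) (x y : Fin n → K), rankDist F x y = w →
      -- intersection of two spheres
      (((rankSphere F x u ∩ rankSphere F y s).ncard : ℕ) : ℚ) =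
        1 / ((q : ℚ) ^ (m * n) * rankCount q m n w) *
          ∑ i ∈ Finset.range (n + 1), rankCount q m n i *
            qKrawtchouk q m n u i * qKrawtchouk q m n s i * qKrawtchouk q m n w i ∧
      -- intersection of two balls
      (rankBall F x u ∩ rankBall F y s).ncard =
        ∑ a ∈ Finset.range (u + 1), ∑ b ∈ Finset.range (s + 1),
          (rankSphere F x a ∩ rankSphere F y b).ncard ∧
      (((rankBall F x u ∩ rankBall F y s).ncard : ℕ) : ℚ) =
        ∑ a ∈ Finset.range (u + 1), ∑ b ∈ Finset.range (s + 1),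
          1 / ((q : ℚ) ^ (m * n) * rankCount q m n w) *
            ∑ i ∈ Finset.range (n + 1), rankCount q m n i *
              qKrawtchouk q m n a i * qKrawtchouk q m n b i * qKrawtchouk q m n w i := by
  subst hq hm
  refine ⟨fun r ↦ natCard_rankWeight_eq r, ?_⟩
  rintro u s w x y rfl
  refine ⟨ncard_rankSphere_inter u s x y, ncard_rankBall_inter u s x y, ?_⟩
  rw [ncard_rankBall_inter]
  push_cast
  exact Finset.sum_congr rfl fun a _ ↦ Finset.sum_congr rfl fun b _ ↦
    ncard_rankSphere_inter a b x y
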